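/- Let $\mathbb{K}$ be a field, let $G$ be the complete graph on a vertex set $V$ with $n\ge 1$ elements, and let $S=\mathbb{K}[x_v : v\in V]$ with the standard grading. Let $$J(G)=\Big(\prod_{v\in C}x_v \;\Big|\; C \text{ is a minimal vertex cover of } G\Big)\subseteq S$$ be the cover ideal of $G$, and let $\deg(J(G))=\max\{|C| : C \text{ is a minimal vertex cover of } G\}$. For an ideal $I\subseteq S$ and $s\ge 1$ let $I^{(s)}=\bigcap_{\mathfrak p\in \mathrm{Ass}(S/I)}(I^sS_{\mathfrak p}\cap S)$ be its $s$-th symbolic power, and for a finitely generated graded $S$-module $M$ let $\mathrm{reg}(M)=\max\{j-i : \mathrm{Tor}_i^S(M,\mathbb{K})_j\neq 0\}$ be its Castelnuovo–Mumford regularity. Then, for all $s\ge 1$, $$\mathrm{reg}\big(J(G)^{(s)}\big)=s\cdot\deg(J(G))=s(n-1).$$ -/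

import Mathlib

open scoped TensorProduct

section Algebra

/-- The `s`-th symbolic power `⋂_{p ∈ Ass(R/I)} (I^s R_p ∩ R)` of an ideal `I`. -/
def symbolicPower {R : Type*} [CommRing R] (I : Ideal R) (s : ℕ) : Ideal R :=
  ⨅ p : PrimeSpectrum R, ⨅ _ : p.asIdeal ∈ associatedPrimes R (R ⧸ I),
    ((I ^ s).map (algebraMap R (Localization.AtPrime p.asIdeal))).comap
      (algebraMap R (Localization.AtPrime p.asIdeal))

/-- The degree-`j` component `S_j` of the polynomial ring `S = K[x_v : v ∈ V]` with its standard
grading, indexed by all integers (`S_j = 0` for `j < 0`). -/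
def polyGrading (K V : Type*) [Field K] (j : ℤ) : Submodule K (MvPolynomial V K) where
  carrier := {f | ∀ m ∈ f.support, (m.degree : ℤ) = j}
  zero_mem' := by simp
  add_mem' := by
    classical
    intro f g hf hg m hm
    rcases Finset.mem_union.mp (MvPolynomial.support_add hm) with h | h
    · exact hf m h
    · exact hg m h
  smul_mem' := fun _ _ hf m hm => hf m (MvPolynomial.support_smul hm)

/-- In nonnegative degrees this is Mathlib's space of homogeneous polynomials. -/
theorem polyGrading_natCast (K V : Type*) [Field K] (n : ℕ) :
    polyGrading K V (n : ℤ) = MvPolynomial.homogeneousSubmodule V K n := by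
  ext f
  rw [MvPolynomial.mem_homogeneousSubmodule]
  constructor
  · intro h m hm
    have h1 : (m.degree : ℤ) = n := h m (MvPolynomial.mem_support_iff.mpr hm)
    change Finsupp.weight (fun _ => 1) m = n
    rw [← Finsupp.degree_eq_weight_one]
    exact_mod_cast h1
  · intro h m hm
    have h1 := h (MvPolynomial.mem_support_iff.mp hm)
    change Finsupp.weight (fun _ => 1) m = n at h1
    rw [← Finsupp.degree_eq_weight_one] at h1
    exact_mod_cast h1

/-- The degree-`j` component of the graded free module `⨁_a S(-δ a)`, whose basis vector `e_a`
has degree `δ a`: the vectors whose `a`-th coordinate lies in `S_{j - δ a}` for every `a`. -/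
def freeGrading (K V : Type*) [Field K] {ι : Type*} (δ : ι → ℤ) (j : ℤ) :
    Submodule K (ι →₀ MvPolynomial V K) where
  carrier := {f | ∀ a, f a ∈ polyGrading K V (j - δ a)}
  zero_mem' := fun _ => Submodule.zero_mem _
  add_mem' := fun hf hg a => Submodule.add_mem _ (hf a) (hg a)
  smul_mem' := fun c _ hf a => Submodule.smul_mem _ c (hf a)

/-- The residue field `K = S/𝔪` as an `S`-module, `𝔪 = (x_v : v ∈ V)`. -/
abbrev ResidueModule (K V : Type*) [Field K] : Type _ :=
  MvPolynomial V K ⧸ Ideal.span (Set.range (MvPolynomial.X : V → MvPolynomial V K))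

/-- A graded free resolution
`⋯ → F_2 → F_1 → F_0 → M → 0` of the graded `S`-module `M = ⨁_j ℳ j`, with
`F_i = ⨁_{a ∈ ι i} S(-δ i a)` and all maps homogeneous of degree `0`. -/
structure GradedFreeResolution {K V : Type*} [Field K] {M : Type*} [AddCommGroup M]
    [Module K M] [Module (MvPolynomial V K) M] (ℳ : ℤ → Submodule K M) where
  /-- index set of a homogeneous basis of `F_i` -/
  ι : ℕ → Type
  /-- degrees of the basis elements -/
  δ : ∀ i, ι i → ℤ
  /-- differential `F_{i+1} → F_i` -/
  d : ∀ i, (ι (i + 1) →₀ MvPolynomial V K) →ₗ[MvPolynomial V K] (ι i →₀ MvPolynomial V K)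
  /-- augmentation `F_0 → M` -/
  ε : (ι 0 →₀ MvPolynomial V K) →ₗ[MvPolynomial V K] M
  d_mem : ∀ i j, ∀ f ∈ freeGrading K V (δ (i + 1)) j, d i f ∈ freeGrading K V (δ i) j
  ε_mem : ∀ j, ∀ f ∈ freeGrading K V (δ 0) j, ε f ∈ ℳ j
  ε_surjective : Function.Surjective ε
  exact_zero : Function.Exact (d 0) ε
  exact_succ : ∀ i, Function.Exact (d (i + 1)) (d i)

namespace GradedFreeResolution

variable {K V : Type*} [Field K] {M : Type*} [AddCommGroup M]
  [Module K M] [Module (MvPolynomial V K) M] {ℳ : ℤ → Submodule K M}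

/-- The module `F_i ⊗_S K`. -/
def Fiber (F : GradedFreeResolution (V := V) ℳ) (i : ℕ) : Type _ :=
  (F.ι i →₀ MvPolynomial V K) ⊗[MvPolynomial V K] ResidueModule K V

noncomputable instance (F : GradedFreeResolution (V := V) ℳ) (i : ℕ) :
    AddCommGroup (F.Fiber i) :=
  inferInstanceAs (AddCommGroup
    ((F.ι i →₀ MvPolynomial V K) ⊗[MvPolynomial V K] ResidueModule K V))

noncomputable instance (F : GradedFreeResolution (V := V) ℳ) (i : ℕ) :
    Module (MvPolynomial V K) (F.Fiber i) :=
  inferInstanceAs (Module (MvPolynomial V K)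
    ((F.ι i →₀ MvPolynomial V K) ⊗[MvPolynomial V K] ResidueModule K V))

noncomputable instance (F : GradedFreeResolution (V := V) ℳ) (i : ℕ) :
    Module K (F.Fiber i) :=
  inferInstanceAs (Module K
    ((F.ι i →₀ MvPolynomial V K) ⊗[MvPolynomial V K] ResidueModule K V))

instance (F : GradedFreeResolution (V := V) ℳ) (i : ℕ) :
    IsScalarTower K (MvPolynomial V K) (F.Fiber i) :=
  inferInstanceAs (IsScalarTower K (MvPolynomial V K)
    ((F.ι i →₀ MvPolynomial V K) ⊗[MvPolynomial V K] ResidueModule K V))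

/-- The map `x ↦ x ⊗ 1` from `F_i` to `F_i ⊗_S K`. -/
noncomputable def toFiber (F : GradedFreeResolution (V := V) ℳ) (i : ℕ) :
    (F.ι i →₀ MvPolynomial V K) →ₗ[MvPolynomial V K] F.Fiber i :=
  (TensorProduct.mk (MvPolynomial V K) (F.ι i →₀ MvPolynomial V K)
    (ResidueModule K V)).flip 1

/-- The differential `d ⊗ 1 : F_{i+1} ⊗_S K → F_i ⊗_S K`. -/
noncomputable def fiberMap (F : GradedFreeResolution (V := V) ℳ) (i : ℕ) :
    F.Fiber (i + 1) →ₗ[MvPolynomial V K] F.Fiber i :=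
  (F.d i).rTensor (ResidueModule K V)

/-- The `i`-cycles of the complex `F ⊗_S K` (everything for `i = 0`). -/
noncomputable def cycles (F : GradedFreeResolution (V := V) ℳ) :
    (i : ℕ) → Submodule (MvPolynomial V K) (F.Fiber i)
  | 0 => ⊤
  | i + 1 => LinearMap.ker (F.fiberMap i)

/-- The `i`-boundaries of the complex `F ⊗_S K`. -/
noncomputable def boundaries (F : GradedFreeResolution (V := V) ℳ) (i : ℕ) :
    Submodule (MvPolynomial V K) (F.Fiber i) :=
  LinearMap.range (F.fiberMap i)

/-- `Tor_i^S(M, K)`, computed as the homology `H_i(F ⊗_S K)`. -/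
abbrev Tor (F : GradedFreeResolution (V := V) ℳ) (i : ℕ) : Type _ :=
  F.cycles i ⧸ (F.boundaries i).submoduleOf (F.cycles i)

/-- The degree-`j` component of `F_i ⊗_S K`: the image of the degree-`j` component of `F_i`
(the factor `K` is concentrated in degree `0`). -/
noncomputable def fiberGrading (F : GradedFreeResolution (V := V) ℳ) (i : ℕ) (j : ℤ) :
    Submodule K (F.Fiber i) :=
  (freeGrading K V (F.δ i) j).map ((F.toFiber i).restrictScalars K)

/-- `Tor_i^S(M, K)_j`: the classes of the cycles of degree `j`. -/
noncomputable def torGrading (F : GradedFreeResolution (V := V) ℳ) (i : ℕ) (j : ℤ) :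
    Submodule K (F.Tor i) :=
  ((F.fiberGrading i j).comap ((F.cycles i).subtype.restrictScalars K)).map
    (((F.boundaries i).submoduleOf (F.cycles i)).mkQ.restrictScalars K)

end GradedFreeResolution

/-- `HasRegularity ℳ r` says that the Castelnuovo-Mumford regularity
`max {j - i : Tor_i^S(M, K)_j ≠ 0}` of the graded `S`-module `M = ⨁_j ℳ j` exists and equals `r`.
Here `Tor` may be computed from any graded free resolution of `M`. -/
def HasRegularity {K V : Type*} [Field K] {M : Type*} [AddCommGroup M]
    [Module K M] [Module (MvPolynomial V K) M] (ℳ : ℤ → Submodule K M) (r : ℤ) : Prop :=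
  IsGreatest {t : ℤ | ∃ (F : GradedFreeResolution (V := V) ℳ) (i : ℕ) (j : ℤ),
    F.torGrading i j ≠ ⊥ ∧ t = j - i} r

/-- The grading that an ideal of `S` (regarded as an `S`-module) inherits from `S`. -/
noncomputable def idealGrading {K V : Type*} [Field K] (I : Ideal (MvPolynomial V K)) (j : ℤ) :
    Submodule K I :=
  (polyGrading K V j).comap (I.subtype.restrictScalars K)

end Algebra

section Graphs

/-- `C` is a minimal vertex cover of `G`. -/
def IsMinimalVertexCover {V : Type*} (G : SimpleGraph V) (C : Finset V) : Prop :=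
  Minimal (fun C : Finset V => G.IsVertexCover (C : Set V)) C

/-- The cover ideal `J(G) ⊆ K[x_v : v ∈ V]`, generated by the monomials `∏_{v ∈ C} x_v` over the
minimal vertex covers `C` of `G`. -/
noncomputable def coverIdeal (K : Type*) [Field K] {V : Type*} (G : SimpleGraph V) :
    Ideal (MvPolynomial V K) :=
  Ideal.span {f | ∃ C : Finset V, IsMinimalVertexCover G C ∧ f = ∏ v ∈ C, MvPolynomial.X v}

open Classical in
/-- `deg(J(G))`, the maximum of `|C|` over the minimal vertex covers `C` of `G`. -/
noncomputable def coverIdealDeg {V : Type*} [Fintype V] (G : SimpleGraph V) : ℕ :=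
  (Finset.univ.filter fun C : Finset V => IsMinimalVertexCover G C).sup Finset.card

end Graphs

/-! ### Graded free resolutions: comparison maps and homotopies. -/

section GradedComparison

variable {K V : Type*} [Field K]

/-! Vertex covers of a complete graph miss at most one vertex, so `J` is the intersection of the
primes `(x_i, x_j)` over `i ≠ j`. These are its associated primes, and near `(x_i, x_j)` the ideal
`J` equals that prime. Hence `J^(s)` is the monomial ideal of all `x^m` with `m i + m j ≥ s` for all
`i ≠ j` (`mem_symbolicPower_coverIdeal_top`).

Only the smallest exponent of such an `m` can be below `s / 2`. So `J^(s)` is generated by the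
monomials `x_i^c ∏_{v ≠ i} x_v^(s - c)` with `c ≤ s / 2`. Order them by decreasing `c`, and by
vertex within a layer. Multiplying such a generator by `x_i` makes it divisible by an earlier one,
while every earlier one has a strictly larger exponent at `x_i`. Each successive colon ideal is
therefore `(x_i)`, a linear quotient by a single variable.

Such an ideal has a resolution of length one: a generator of degree `D` other than the first
contributes one relation, of degree `D + 1`. Hence every basis element satisfies `j - i ≤ max D`.
For `n ≥ 2` the degree `c + (n - 1)(s - c)` is largest at `c = 0`, where it is `s(n - 1)`. The last
generator has this degree and survives in `Tor_0`, because its row of the relation matrix lies in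
the maximal ideal (`MonomialLinearQuotients.hasRegularity`).

Since regularity here allows an arbitrary graded free resolution, the upper bound also needs
independence of the resolution. Graded chain maps and homotopies supply it
(`exists_degree_of_torGrading_ne_bot`). -/

theorem mem_polyGrading_iff {j : ℤ} {f : MvPolynomial V K} :
    f ∈ polyGrading K V j ↔ ∀ m, f.coeff m ≠ 0 → (m.degree : ℤ) = j := by
  simp only [← MvPolynomial.mem_support_iff]; rfl

/-- The projection of `S` onto its degree-`j` component. -/
noncomputable def polyProj (K V : Type*) [Field K] (j : ℤ) :
    MvPolynomial V K →ₗ[K] MvPolynomial V K :=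
  if 0 ≤ j then MvPolynomial.homogeneousComponent j.toNat else 0

theorem coeff_polyProj (j : ℤ) (f : MvPolynomial V K) (m : V →₀ ℕ) :
    (polyProj K V j f).coeff m = if (m.degree : ℤ) = j then f.coeff m else 0 := by
  unfold polyProj
  split_ifs with h h' h'
  · rw [MvPolynomial.coeff_homogeneousComponent, if_pos (by omega)]
  · rw [MvPolynomial.coeff_homogeneousComponent, if_neg (by omega)]
  · omega
  · simp

theorem polyProj_mem (j : ℤ) (f : MvPolynomial V K) : polyProj K V j f ∈ polyGrading K V j := by
  rw [mem_polyGrading_iff]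
  intro m hm
  rw [coeff_polyProj] at hm
  by_contra h
  exact hm (if_neg h)

theorem polyProj_of_mem {j : ℤ} {f : MvPolynomial V K} (hf : f ∈ polyGrading K V j) :
    polyProj K V j f = f := by
  ext m
  rw [coeff_polyProj]
  split_ifs with h
  · rfl
  · by_contra h'
    exact h (mem_polyGrading_iff.mp hf m (Ne.symm h'))

theorem polyProj_of_mem_of_ne {j k : ℤ} {f : MvPolynomial V K} (hf : f ∈ polyGrading K V k)
    (hjk : k ≠ j) : polyProj K V j f = 0 := by
  ext m
  rw [coeff_polyProj, MvPolynomial.coeff_zero]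
  split_ifs with h
  · by_contra h'
    exact hjk ((mem_polyGrading_iff.mp hf m h').symm.trans h)
  · rfl

theorem monomial_mem_polyGrading (m : V →₀ ℕ) (c : K) :
    MvPolynomial.monomial m c ∈ polyGrading K V m.degree := by
  classical
  rw [mem_polyGrading_iff]
  intro m' h
  rw [MvPolynomial.coeff_monomial] at h
  by_cases h' : m = m'
  · rw [h']
  · exact absurd (if_neg h') h

theorem X_mem_polyGrading (v : V) : (MvPolynomial.X v : MvPolynomial V K) ∈ polyGrading K V 1 := by
  have := monomial_mem_polyGrading (K := K) (Finsupp.single v 1) 1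
  simpa [MvPolynomial.X] using this

theorem one_mem_polyGrading : (1 : MvPolynomial V K) ∈ polyGrading K V 0 := by
  have := monomial_mem_polyGrading (K := K) (0 : V →₀ ℕ) 1
  simpa using this

theorem mul_mem_polyGrading {i j : ℤ} {f g : MvPolynomial V K} (hf : f ∈ polyGrading K V i)
    (hg : g ∈ polyGrading K V j) : f * g ∈ polyGrading K V (i + j) := by
  classical
  rw [mem_polyGrading_iff] at *
  intro m hm
  rw [MvPolynomial.coeff_mul] at hm
  obtain ⟨x, hx, hne⟩ := Finset.exists_ne_zero_of_sum_ne_zero hm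
  rw [Finset.HasAntidiagonal.mem_antidiagonal] at hx
  rw [← hf _ (left_ne_zero_of_mul hne), ← hg _ (right_ne_zero_of_mul hne), ← hx, map_add]
  push_cast; rfl

theorem single_mem_freeGrading {ι : Type*} (δ : ι → ℤ) {j : ℤ} (a : ι) {f : MvPolynomial V K}
    (hf : f ∈ polyGrading K V (j - δ a)) : Finsupp.single a f ∈ freeGrading K V δ j := by
  classical
  intro b
  rw [Finsupp.single_apply]
  split_ifs with h
  · exact h ▸ hf
  · exact Submodule.zero_mem _

theorem single_one_mem_freeGrading {ι : Type*} (δ : ι → ℤ) (a : ι) :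
    Finsupp.single a (1 : MvPolynomial V K) ∈ freeGrading K V δ (δ a) :=
  single_mem_freeGrading δ a (by rw [sub_self]; exact one_mem_polyGrading)

theorem smul_mem_freeGrading {ι : Type*} (δ : ι → ℤ) {i j : ℤ} {p : MvPolynomial V K}
    {f : ι →₀ MvPolynomial V K} (hp : p ∈ polyGrading K V i) (hf : f ∈ freeGrading K V δ j) :
    p • f ∈ freeGrading K V δ (i + j) := by
  intro a
  rw [add_sub_assoc]
  exact mul_mem_polyGrading hp (hf a)

/-- The projection of a graded free module onto its degree-`j` component. -/
noncomputable def freeProj {ι : Type*} (δ : ι → ℤ) (j : ℤ) :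
    (ι →₀ MvPolynomial V K) →ₗ[K] (ι →₀ MvPolynomial V K) where
  toFun f := Finsupp.onFinset f.support (fun a => polyProj K V (j - δ a) (f a))
    (fun a h => by
      rw [Finsupp.mem_support_iff]
      intro h'
      exact h (by rw [h', map_zero]))
  map_add' f g := by ext a : 1; simp
  map_smul' c f := by ext a : 1; simp

theorem freeProj_mem {ι : Type*} (δ : ι → ℤ) (j : ℤ) (f : ι →₀ MvPolynomial V K) :
    freeProj δ j f ∈ freeGrading K V δ j := fun _ => polyProj_mem _ _

theorem freeProj_of_mem {ι : Type*} {δ : ι → ℤ} {j : ℤ} {f : ι →₀ MvPolynomial V K}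
    (hf : f ∈ freeGrading K V δ j) : freeProj δ j f = f := by
  ext a : 1
  exact polyProj_of_mem (hf a)

theorem freeProj_of_mem_of_ne {ι : Type*} {δ : ι → ℤ} {j k : ℤ} {f : ι →₀ MvPolynomial V K}
    (hf : f ∈ freeGrading K V δ k) (hjk : k ≠ j) : freeProj δ j f = 0 := by
  ext a : 1
  exact polyProj_of_mem_of_ne (hf a) (by omega)

/-- A degree-preserving map out of a graded free module commutes with the projections onto
homogeneous components. -/
theorem map_freeProj {ι N : Type*} [AddCommGroup N] [Module K N] {δ : ι → ℤ}
    {𝒩 : ℤ → Submodule K N} (π : ℤ → N →ₗ[K] N)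
    (hπ : ∀ {j x}, x ∈ 𝒩 j → π j x = x) (hπ' : ∀ {j k x}, x ∈ 𝒩 k → k ≠ j → π j x = 0)
    (L : (ι →₀ MvPolynomial V K) →ₗ[K] N)
    (hL : ∀ j, ∀ f ∈ freeGrading K V δ j, L f ∈ 𝒩 j) (j : ℤ) (f : ι →₀ MvPolynomial V K) :
    L (freeProj δ j f) = π j (L f) := by
  induction f using Finsupp.induction_linear with
  | zero => simp
  | add f g hf hg => simp [hf, hg]
  | single a p =>
    induction p using MvPolynomial.induction_on' with
    | monomial m c =>
      have h : Finsupp.single a (MvPolynomial.monomial m c : MvPolynomial V K) ∈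
          freeGrading K V δ (m.degree + δ a) :=
        single_mem_freeGrading δ a (by simpa using monomial_mem_polyGrading (K := K) m c)
      by_cases hj : m.degree + δ a = j
      · subst hj
        rw [freeProj_of_mem h, hπ (hL _ _ h)]
      · rw [freeProj_of_mem_of_ne h hj, hπ' (hL _ _ h) hj, map_zero]
    | add p q hp hq =>
      rw [Finsupp.single_add, map_add, map_add, map_add, map_add, hp, hq]

/-- A map of graded modules all of whose homogeneous values are values at homogeneous elements
of the same degree. -/
def HasHomogeneousLifts {κ N : Type*} [AddCommGroup N] [Module K N]
    [Module (MvPolynomial V K) N] (δ : κ → ℤ) (𝒩 : ℤ → Submodule K N)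
    (L : (κ →₀ MvPolynomial V K) →ₗ[MvPolynomial V K] N) : Prop :=
  ∀ j, ∀ y ∈ 𝒩 j, y ∈ LinearMap.range L → ∃ f ∈ freeGrading K V δ j, L f = y

/-- Any preimage can be replaced by its degree-`j` component, since a degree-preserving map commutes
with taking components. -/
theorem hasHomogeneousLifts_free {ι κ : Type*} {δ : ι → ℤ} {δ' : κ → ℤ}
    (L : (ι →₀ MvPolynomial V K) →ₗ[MvPolynomial V K] (κ →₀ MvPolynomial V K))
    (hL : ∀ j, ∀ f ∈ freeGrading K V δ j, L f ∈ freeGrading K V δ' j) :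
    HasHomogeneousLifts δ (freeGrading K V δ') L := by
  rintro j y hy ⟨f, rfl⟩
  refine ⟨freeProj δ j f, freeProj_mem _ _ _, ?_⟩
  exact (map_freeProj (freeProj δ') freeProj_of_mem freeProj_of_mem_of_ne
    (L.restrictScalars K) hL j f).trans (freeProj_of_mem hy)

theorem hasHomogeneousLifts_ideal {ι : Type*} {δ : ι → ℤ} {I : Ideal (MvPolynomial V K)}
    (L : (ι →₀ MvPolynomial V K) →ₗ[MvPolynomial V K] I)
    (hL : ∀ j, ∀ f ∈ freeGrading K V δ j, L f ∈ idealGrading I j) :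
    HasHomogeneousLifts δ (idealGrading I) L := by
  rintro j y hy ⟨f, rfl⟩
  refine ⟨freeProj δ j f, freeProj_mem _ _ _, Subtype.ext ?_⟩
  exact (map_freeProj (polyProj K V) polyProj_of_mem polyProj_of_mem_of_ne
    ((I.subtype ∘ₗ L).restrictScalars K) hL j f).trans (polyProj_of_mem hy)

/-- A map out of a graded free module preserves degrees if it does so on basis vectors. -/
theorem mem_freeGrading_of_basis {ι κ : Type*} {δ : ι → ℤ} {δ' : κ → ℤ}
    (L : (ι →₀ MvPolynomial V K) →ₗ[MvPolynomial V K] (κ →₀ MvPolynomial V K))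
    (hL : ∀ a, L (Finsupp.single a 1) ∈ freeGrading K V δ' (δ a)) (j : ℤ)
    (f : ι →₀ MvPolynomial V K) (hf : f ∈ freeGrading K V δ j) :
    L f ∈ freeGrading K V δ' j := by
  have h : f = f.sum fun a p => p • Finsupp.single a 1 := by
    simp
  rw [h, map_finsuppSum]
  refine Submodule.sum_mem _ fun a _ => ?_
  dsimp only
  rw [map_smul]
  have := smul_mem_freeGrading δ' (hf a) (hL a)
  simpa using this

/-- Graded projectivity of free modules: send each basis vector to a homogeneous preimage of its
image. -/
theorem exists_graded_lift {ι κ N : Type*} [AddCommGroup N] [Module K N]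
    [Module (MvPolynomial V K) N] {δ : ι → ℤ} {δ' : κ → ℤ} {𝒩 : ℤ → Submodule K N}
    {g : (ι →₀ MvPolynomial V K) →ₗ[MvPolynomial V K] N}
    {L : (κ →₀ MvPolynomial V K) →ₗ[MvPolynomial V K] N}
    (hg : ∀ j, ∀ f ∈ freeGrading K V δ j, g f ∈ 𝒩 j)
    (hL : HasHomogeneousLifts δ' 𝒩 L) (hgL : ∀ f, g f ∈ LinearMap.range L) :
    ∃ h : (ι →₀ MvPolynomial V K) →ₗ[MvPolynomial V K] (κ →₀ MvPolynomial V K),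
      (∀ j, ∀ f ∈ freeGrading K V δ j, h f ∈ freeGrading K V δ' j) ∧ ∀ f, L (h f) = g f := by
  choose y hy hLy using fun a : ι =>
    hL (δ a) (g (Finsupp.single a 1)) (hg _ _ (single_one_mem_freeGrading δ a)) (hgL _)
  refine ⟨Finsupp.linearCombination _ y, mem_freeGrading_of_basis _ fun a => ?_, fun f => ?_⟩
  · simpa using hy a
  · have : L ∘ₗ Finsupp.linearCombination _ y = g := by
      ext a
      simpa using hLy a
    exact LinearMap.congr_fun this f

open Classical in
/-- A graded lift of `g` through `L`, if there is one. -/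
noncomputable def gradedLift {ι κ N : Type*} [AddCommGroup N]
    [Module (MvPolynomial V K) N] (δ : ι → ℤ) (δ' : κ → ℤ)
    (g : (ι →₀ MvPolynomial V K) →ₗ[MvPolynomial V K] N)
    (L : (κ →₀ MvPolynomial V K) →ₗ[MvPolynomial V K] N) :
    (ι →₀ MvPolynomial V K) →ₗ[MvPolynomial V K] (κ →₀ MvPolynomial V K) :=
  if h : ∃ h : (ι →₀ MvPolynomial V K) →ₗ[MvPolynomial V K] (κ →₀ MvPolynomial V K),
      (∀ j, ∀ f ∈ freeGrading K V δ j, h f ∈ freeGrading K V δ' j) ∧ ∀ f, L (h f) = g f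
  then h.choose else 0

theorem gradedLift_spec {ι κ N : Type*} [AddCommGroup N] [Module K N]
    [Module (MvPolynomial V K) N] {δ : ι → ℤ} {δ' : κ → ℤ} {𝒩 : ℤ → Submodule K N}
    {g : (ι →₀ MvPolynomial V K) →ₗ[MvPolynomial V K] N}
    {L : (κ →₀ MvPolynomial V K) →ₗ[MvPolynomial V K] N}
    (hg : ∀ j, ∀ f ∈ freeGrading K V δ j, g f ∈ 𝒩 j)
    (hL : HasHomogeneousLifts δ' 𝒩 L) (hgL : ∀ f, g f ∈ LinearMap.range L) :
    (∀ j, ∀ f ∈ freeGrading K V δ j, gradedLift δ δ' g L f ∈ freeGrading K V δ' j) ∧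
      ∀ f, L (gradedLift δ δ' g L f) = g f := by
  unfold gradedLift
  rw [dif_pos (exists_graded_lift hg hL hgL)]
  exact (exists_graded_lift hg hL hgL).choose_spec

namespace GradedFreeResolution

variable {I : Ideal (MvPolynomial V K)}

/-- A graded chain map between two resolutions of the same module, lifting the identity. -/
noncomputable def chainMap (F P : GradedFreeResolution (V := V) (idealGrading I)) : (i : ℕ) →
    (F.ι i →₀ MvPolynomial V K) →ₗ[MvPolynomial V K] (P.ι i →₀ MvPolynomial V K)
  | 0 => gradedLift (F.δ 0) (P.δ 0) F.ε P.ε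
  | i + 1 => gradedLift (F.δ (i + 1)) (P.δ (i + 1)) (F.chainMap P i ∘ₗ F.d i) (P.d i)

theorem chainMap_zero_spec (F P : GradedFreeResolution (V := V) (idealGrading I)) :
    (∀ j, ∀ f ∈ freeGrading K V (F.δ 0) j, F.chainMap P 0 f ∈ freeGrading K V (P.δ 0) j) ∧
      ∀ f, P.ε (F.chainMap P 0 f) = F.ε f :=
  gradedLift_spec F.ε_mem (hasHomogeneousLifts_ideal P.ε P.ε_mem) fun _ => P.ε_surjective _

/-- The composite of the previous chain map with `F.d i` is killed by the next map of `P`, because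
consecutive maps of `F` compose to zero. Exactness of `P` then provides the lift. -/
theorem chainMap_succ_spec (F P : GradedFreeResolution (V := V) (idealGrading I)) (i : ℕ) :
    (∀ j, ∀ f ∈ freeGrading K V (F.δ (i + 1)) j,
      F.chainMap P (i + 1) f ∈ freeGrading K V (P.δ (i + 1)) j) ∧
      ∀ f, P.d i (F.chainMap P (i + 1) f) = F.chainMap P i (F.d i f) := by
  induction i with
  | zero =>
    refine gradedLift_spec (𝒩 := freeGrading K V (P.δ 0))
      (fun j f hf => (F.chainMap_zero_spec P).1 j _ (F.d_mem 0 j f hf))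
      (hasHomogeneousLifts_free _ (P.d_mem 0)) fun f => ?_
    refine (P.exact_zero _).mp ?_
    rw [LinearMap.comp_apply, (F.chainMap_zero_spec P).2]
    exact F.exact_zero.apply_apply_eq_zero f
  | succ i ih =>
    refine gradedLift_spec (𝒩 := freeGrading K V (P.δ (i + 1)))
      (fun j f hf => ih.1 j _ (F.d_mem _ j f hf))
      (hasHomogeneousLifts_free _ (P.d_mem _)) fun f => ?_
    refine (P.exact_succ i _).mp ?_
    rw [LinearMap.comp_apply, ih.2, (F.exact_succ i).apply_apply_eq_zero f, map_zero]

theorem chainMap_mem (F P : GradedFreeResolution (V := V) (idealGrading I)) :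
    ∀ i j, ∀ f ∈ freeGrading K V (F.δ i) j, F.chainMap P i f ∈ freeGrading K V (P.δ i) j
  | 0 => (F.chainMap_zero_spec P).1
  | i + 1 => (F.chainMap_succ_spec P i).1

/-- The defect of `F → P → F` from being the identity. -/
noncomputable def defect (F P : GradedFreeResolution (V := V) (idealGrading I)) (i : ℕ) :
    (F.ι i →₀ MvPolynomial V K) →ₗ[MvPolynomial V K] (F.ι i →₀ MvPolynomial V K) :=
  LinearMap.id - P.chainMap F i ∘ₗ F.chainMap P i

theorem defect_mem (F P : GradedFreeResolution (V := V) (idealGrading I)) (i : ℕ) (j : ℤ)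
    (f : F.ι i →₀ MvPolynomial V K) (hf : f ∈ freeGrading K V (F.δ i) j) :
    F.defect P i f ∈ freeGrading K V (F.δ i) j :=
  Submodule.sub_mem _ hf (P.chainMap_mem F i j _ (F.chainMap_mem P i j f hf))

theorem d_defect (F P : GradedFreeResolution (V := V) (idealGrading I)) (i : ℕ)
    (f : F.ι (i + 1) →₀ MvPolynomial V K) :
    F.d i (F.defect P (i + 1) f) = F.defect P i (F.d i f) := by
  simp only [defect, LinearMap.sub_apply, LinearMap.id_apply, LinearMap.comp_apply, map_sub,
    (F.chainMap_succ_spec P i).2, (P.chainMap_succ_spec F i).2]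

/-- A graded homotopy from `F → P → F` to the identity. -/
noncomputable def homotopy (F P : GradedFreeResolution (V := V) (idealGrading I)) : (i : ℕ) →
    (F.ι i →₀ MvPolynomial V K) →ₗ[MvPolynomial V K] (F.ι (i + 1) →₀ MvPolynomial V K)
  | 0 => gradedLift (F.δ 0) (F.δ 1) (F.defect P 0) (F.d 0)
  | i + 1 => gradedLift (F.δ (i + 1)) (F.δ (i + 2))
      (F.defect P (i + 1) - F.homotopy P i ∘ₗ F.d i) (F.d (i + 1))

theorem homotopy_zero_spec (F P : GradedFreeResolution (V := V) (idealGrading I)) :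
    (∀ j, ∀ f ∈ freeGrading K V (F.δ 0) j, F.homotopy P 0 f ∈ freeGrading K V (F.δ 1) j) ∧
      ∀ f, F.d 0 (F.homotopy P 0 f) = F.defect P 0 f := by
  refine gradedLift_spec (F.defect_mem P 0) (hasHomogeneousLifts_free _ (F.d_mem 0)) fun f => ?_
  refine (F.exact_zero _).mp ?_
  simp only [defect, LinearMap.sub_apply, LinearMap.id_apply, LinearMap.comp_apply, map_sub,
    (F.chainMap_zero_spec P).2, (P.chainMap_zero_spec F).2, sub_self]

/-- The defect minus the previous homotopy term consists of cycles, by the homotopy identity one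
step below, so exactness of `F` lets it be lifted. -/
theorem homotopy_succ_spec (F P : GradedFreeResolution (V := V) (idealGrading I)) (i : ℕ) :
    (∀ j, ∀ f ∈ freeGrading K V (F.δ (i + 1)) j,
      F.homotopy P (i + 1) f ∈ freeGrading K V (F.δ (i + 2)) j) ∧
      ∀ f, F.d (i + 1) (F.homotopy P (i + 1) f) =
        F.defect P (i + 1) f - F.homotopy P i (F.d i f) := by
  induction i with
  | zero =>
    refine gradedLift_spec (𝒩 := freeGrading K V (F.δ 1))
      (fun j f hf => Submodule.sub_mem _ (F.defect_mem P _ j f hf)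
        ((F.homotopy_zero_spec P).1 j _ (F.d_mem _ j f hf)))
      (hasHomogeneousLifts_free _ (F.d_mem 1)) fun f => (F.exact_succ 0 _).mp ?_
    rw [LinearMap.sub_apply, LinearMap.comp_apply, map_sub, (F.homotopy_zero_spec P).2,
      d_defect, sub_self]
  | succ i ih =>
    refine gradedLift_spec (𝒩 := freeGrading K V (F.δ (i + 2)))
      (fun j f hf => Submodule.sub_mem _ (F.defect_mem P _ j f hf)
        (ih.1 j _ (F.d_mem _ j f hf)))
      (hasHomogeneousLifts_free _ (F.d_mem _)) fun f => (F.exact_succ _ _).mp ?_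
    rw [LinearMap.sub_apply, LinearMap.comp_apply, map_sub, ih.2, d_defect,
      (F.exact_succ i).apply_apply_eq_zero, map_zero, sub_zero, sub_self]

theorem rTensor_toFiber {ι κ : Type*}
    (L : (ι →₀ MvPolynomial V K) →ₗ[MvPolynomial V K] (κ →₀ MvPolynomial V K))
    (f : ι →₀ MvPolynomial V K) :
    L.rTensor (ResidueModule K V) (f ⊗ₜ[MvPolynomial V K] 1) = L f ⊗ₜ 1 := by
  simp

theorem toFiber_apply (F : GradedFreeResolution (V := V) (idealGrading I)) (i : ℕ)
    (f : F.ι i →₀ MvPolynomial V K) :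
    F.toFiber i f = f ⊗ₜ[MvPolynomial V K] (1 : ResidueModule K V) := rfl

theorem fiberMap_toFiber (F : GradedFreeResolution (V := V) (idealGrading I)) (i : ℕ)
    (f : F.ι (i + 1) →₀ MvPolynomial V K) :
    F.fiberMap i (F.toFiber (i + 1) f) = F.toFiber i (F.d i f) :=
  rTensor_toFiber (F.d i) f

theorem mem_span_X_of_mem_polyGrading {j : ℤ} (hj : j ≠ 0) {p : MvPolynomial V K}
    (hp : p ∈ polyGrading K V j) :
    p ∈ Ideal.span (Set.range (MvPolynomial.X : V → MvPolynomial V K)) := by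
  rw [← Set.image_univ, MvPolynomial.mem_ideal_span_X_image]
  intro m hm
  by_contra! h
  have : m = 0 := by ext v; simpa using h v (Set.mem_univ v)
  have h1 := hp m hm
  rw [this] at h1
  exact hj (by simpa using h1.symm)

theorem smul_tmul_residue {N : Type*} [AddCommGroup N] [Module (MvPolynomial V K) N]
    {p : MvPolynomial V K}
    (hp : p ∈ Ideal.span (Set.range (MvPolynomial.X : V → MvPolynomial V K))) (x : N)
    (y : ResidueModule K V) :
    (p • x) ⊗ₜ[MvPolynomial V K] y = 0 := by
  obtain ⟨q, rfl⟩ := Ideal.Quotient.mk_surjective y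
  rw [TensorProduct.smul_tmul]
  have : p • (Ideal.Quotient.mk (Ideal.span (Set.range
      (MvPolynomial.X : V → MvPolynomial V K)))) q = 0 := by
    change Ideal.Quotient.mk _ (p * q) = 0
    exact Ideal.Quotient.eq_zero_iff_mem.mpr (Ideal.mul_mem_right _ _ hp)
  rw [this, TensorProduct.tmul_zero]

/-- The degrees in which `Tor_i` lives occur among the degrees of the basis elements of the
`i`-th module of any graded free resolution. -/
theorem exists_degree_of_torGrading_ne_bot
    (F P : GradedFreeResolution (V := V) (idealGrading I)) {i : ℕ} {j : ℤ}
    (h : F.torGrading i j ≠ ⊥) : ∃ a, P.δ i a = j := by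
  by_contra! hP
  apply h
  rw [eq_bot_iff]
  rintro _ ⟨⟨_, hz⟩, ⟨f, hf, rfl⟩, rfl⟩
  rw [Submodule.mem_bot]
  refine (Submodule.Quotient.mk_eq_zero _).mpr ?_
  change F.toFiber i f ∈ F.cycles i at hz
  change F.toFiber i f ∈ F.boundaries i
  -- The coordinates of the image of `f` in `P` are homogeneous of degree `j - δ a`, nonzero by
  -- assumption. They lie in the maximal ideal and die in the fiber, so only the defect of `f`
  -- remains.
  have h0 : F.toFiber i (P.chainMap F i (F.chainMap P i f)) = 0 := by
    have hx := F.chainMap_mem P i j f hf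
    generalize F.chainMap P i f = x at hx
    have hx' : x = x.sum fun a p => p • Finsupp.single a 1 := by
      simp
    rw [hx', map_finsuppSum, map_finsuppSum]
    refine Finset.sum_eq_zero fun a _ => ?_
    dsimp only
    rw [map_smul, toFiber_apply]
    exact smul_tmul_residue (mem_span_X_of_mem_polyGrading (sub_ne_zero.mpr (hP a).symm) (hx a))
      _ _
  have h1 : F.toFiber i f = F.toFiber i (F.defect P i f) := by
    rw [defect, LinearMap.sub_apply, map_sub, LinearMap.comp_apply, h0, sub_zero,
      LinearMap.id_apply]
  rw [h1]
  cases i with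
  | zero =>
    rw [← (F.homotopy_zero_spec P).2, ← fiberMap_toFiber]
    exact ⟨_, rfl⟩
  | succ i =>
    -- The homotopy descends to the fibers, where the class of `F.d i f` is zero because `f`
    -- represents a cycle.
    have h2 : F.toFiber (i + 1) (F.homotopy P i (F.d i f)) = 0 := by
      have h3 : F.toFiber i (F.d i f) = 0 := by
        rw [← fiberMap_toFiber]
        exact LinearMap.mem_ker.mp hz
      rw [toFiber_apply] at h3 ⊢
      rw [← rTensor_toFiber]
      exact (congrArg _ h3).trans (map_zero _)
    have h4 := congrArg (F.toFiber (i + 1)) ((F.homotopy_succ_spec P i).2 f)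
    rw [map_sub, h2, sub_zero, ← fiberMap_toFiber] at h4
    rw [← h4]
    exact ⟨_, rfl⟩

end GradedFreeResolution

end GradedComparison

/-! ### Resolution and regularity of monomial ideals with one-variable linear quotients. -/

section LinearQuotients

variable {K V : Type*} [Field K]

/-- If the exponents of `X v` are larger in all other monomials, then in any syzygy the
coefficient of a monomial is divisible by `X v`. -/
theorem X_dvd_of_sum_eq_zero {α : Type*} {E : α → V →₀ ℕ} {v : V} {a : α}
    {g : α →₀ MvPolynomial V K} (hE : ∀ b ∈ g.support, b ≠ a → E a v < E b v)
    (hg : (g.sum fun b p => p * MvPolynomial.monomial (E b) 1) = 0) :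
    MvPolynomial.X v ∣ g a := by
  classical
  rw [MvPolynomial.X_dvd_iff_modMonomial_eq_zero]
  ext m
  rw [MvPolynomial.coeff_zero]
  by_cases hm : Finsupp.single v 1 ≤ m
  · exact MvPolynomial.coeff_modMonomial_of_le _ hm
  rw [MvPolynomial.coeff_modMonomial_of_not_le _ hm]
  have hmv : m v = 0 := by
    by_contra h
    exact hm (Finsupp.single_le_iff.mpr (Nat.one_le_iff_ne_zero.mpr h))
  by_cases ha : a ∈ g.support
  swap
  · rw [Finsupp.notMem_support_iff.mp ha, MvPolynomial.coeff_zero]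
  -- For `m` free of `v`, the monomial `m + E a` has exponent `E a v` at `v`, too small to occur in
  -- any other summand. So the coefficient of `g a` at `m` must vanish.
  have h := congrArg (MvPolynomial.coeff (m + E a)) hg
  rw [Finsupp.sum, MvPolynomial.coeff_sum, Finset.sum_eq_single_of_mem a ha] at h
  · simpa [MvPolynomial.coeff_mul_monomial'] using h
  · intro b hb hba
    rw [MvPolynomial.coeff_mul_monomial', if_neg]
    intro hle
    have h1 := hle v
    have h2 := hE b hb hba
    rw [Finsupp.add_apply, hmv] at h1
    omega

/-- A finite family of monomials with exponent vectors `E a`, ordered such that each one except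
the first, modulo the preceding ones, is annihilated exactly by one variable. -/
structure MonomialLinearQuotients (V : Type*) where
  /-- index set of the monomials -/
  index : Type
  [linearOrder : LinearOrder index]
  [finite : Finite index]
  /-- the first monomial -/
  bot : index
  /-- the exponent vectors -/
  exponent : index → V →₀ ℕ
  /-- the variable annihilating a monomial modulo the preceding ones -/
  var : index → V
  /-- a preceding monomial that divides the product of a monomial and its variable -/
  parent : index → index
  bot_le : ∀ a, bot ≤ a
  parent_lt : ∀ a, a ≠ bot → parent a < a
  exponent_parent_le : ∀ a, a ≠ bot →
    exponent (parent a) ≤ exponent a + Finsupp.single (var a) 1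
  exponent_lt : ∀ a b, b < a → exponent a (var a) < exponent b (var a)

namespace MonomialLinearQuotients

attribute [instance] linearOrder finite

variable (Q : MonomialLinearQuotients V)

variable (K) in
/-- The ideal generated by the monomials. -/
noncomputable def ideal : Ideal (MvPolynomial V K) :=
  Ideal.span (Set.range fun a => MvPolynomial.monomial (Q.exponent a) 1)

variable (K) in
/-- The relation expressing that `X (var a)` annihilates the monomial `a` modulo its parent. -/
noncomputable def relation (a : Q.index) : Q.index →₀ MvPolynomial V K :=
  Finsupp.single a (MvPolynomial.X (Q.var a)) -
    Finsupp.single (Q.parent a) (MvPolynomial.monomial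
      (Q.exponent a + Finsupp.single (Q.var a) 1 - Q.exponent (Q.parent a)) 1)

variable (K) in
/-- The matrix of relations. -/
noncomputable def relationMap :
    ({a // a ≠ Q.bot} →₀ MvPolynomial V K) →ₗ[MvPolynomial V K]
      (Q.index →₀ MvPolynomial V K) :=
  Finsupp.linearCombination _ fun a => Q.relation K a.1

variable (K) in
/-- The map sending basis vectors to the generating monomials. -/
noncomputable def augmentation :
    (Q.index →₀ MvPolynomial V K) →ₗ[MvPolynomial V K] Q.ideal K :=
  Finsupp.linearCombination _ fun a =>
    ⟨MvPolynomial.monomial (Q.exponent a) 1, Ideal.subset_span ⟨a, rfl⟩⟩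

theorem coe_augmentation (f : Q.index →₀ MvPolynomial V K) :
    (Q.augmentation K f : MvPolynomial V K) =
      f.sum fun a p => p * MvPolynomial.monomial (Q.exponent a) 1 := by
  rw [augmentation, Finsupp.linearCombination_apply, Finsupp.sum, Finsupp.sum,
    AddSubmonoidClass.coe_finsetSum]
  rfl

theorem augmentation_single (a : Q.index) (p : MvPolynomial V K) :
    (Q.augmentation K (Finsupp.single a p) : MvPolynomial V K) =
      p * MvPolynomial.monomial (Q.exponent a) 1 := by
  rw [coe_augmentation, Finsupp.sum_single_index (by simp)]

theorem augmentation_surjective : Function.Surjective (Q.augmentation K) := by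
  rintro ⟨y, hy⟩
  rw [ideal, ← Ideal.submodule_span_eq, Finsupp.mem_span_range_iff_exists_finsupp] at hy
  obtain ⟨f, hf⟩ := hy
  exact ⟨f, Subtype.ext ((Q.coe_augmentation f).trans hf)⟩

theorem augmentation_relation {a : Q.index} (ha : a ≠ Q.bot) :
    Q.augmentation K (Q.relation K a) = 0 := by
  apply Subtype.ext
  rw [relation, map_sub, AddSubgroupClass.coe_sub, augmentation_single, augmentation_single,
    MvPolynomial.monomial_mul, tsub_add_cancel_of_le (Q.exponent_parent_le a ha),
    MvPolynomial.X, MvPolynomial.monomial_mul, add_comm]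
  simp

theorem relation_self {a : Q.index} (ha : a ≠ Q.bot) :
    Q.relation K a a = MvPolynomial.X (Q.var a) := by
  rw [relation, Finsupp.sub_apply, Finsupp.single_eq_same,
    Finsupp.single_eq_of_ne (Q.parent_lt a ha).ne', sub_zero]

theorem relation_of_lt {a b : Q.index} (ha : a ≠ Q.bot) (hab : a < b) :
    Q.relation K a b = 0 := by
  rw [relation, Finsupp.sub_apply, Finsupp.single_eq_of_ne hab.ne',
    Finsupp.single_eq_of_ne ((Q.parent_lt a ha).trans hab).ne', sub_zero]

/-- The relation matrix is triangular with nonzero diagonal entries `X (var a)`: look at the largest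
index in the support. -/
theorem relationMap_injective : Function.Injective (Q.relationMap K) := by
  rw [injective_iff_map_eq_zero]
  intro f hf
  by_contra hne
  obtain ⟨b, hb, hmax⟩ := f.support.exists_max_image id (Finsupp.support_nonempty_iff.mpr hne)
  have h := DFunLike.congr_fun hf b.1
  rw [relationMap, Finsupp.linearCombination_apply, Finsupp.sum, Finsupp.finsetSum_apply,
    Finset.sum_eq_single_of_mem b hb, Finsupp.smul_apply, Q.relation_self b.2] at h
  · rw [Finsupp.zero_apply, smul_eq_mul, mul_eq_zero] at h
    exact (Finsupp.mem_support_iff.mp hb) (h.resolve_right (MvPolynomial.X_ne_zero _))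
  · intro c hc hcb
    have hlt : c.1 < b.1 := lt_of_le_of_ne (hmax c hc) (Subtype.coe_injective.ne hcb)
    rw [Finsupp.smul_apply, Q.relation_of_lt c.2 hlt, smul_zero]

/-- Elimination from the top: subtracting a multiple of the relation of `a` cancels the leading
coordinate of a syzygy, and induction handles the rest. -/
theorem mem_range_relationMap (a : Q.index) (g : Q.index →₀ MvPolynomial V K)
    (hg : ∀ b ∈ g.support, b ≤ a) (h0 : Q.augmentation K g = 0) :
    g ∈ LinearMap.range (Q.relationMap K) := by
  induction a using WellFoundedLT.induction generalizing g with
  | ind a ih =>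
  have hsum := (Q.coe_augmentation g).symm.trans (congrArg Subtype.val h0)
  by_cases ha : a = Q.bot
  · have hga : g = Finsupp.single a (g a) := by
      ext b : 1
      by_cases hb : b = a
      · rw [hb, Finsupp.single_eq_same]
      · rw [Finsupp.single_eq_of_ne hb]
        by_contra h
        exact hb (le_antisymm (hg b (Finsupp.mem_support_iff.mpr h)) (ha ▸ Q.bot_le b))
    have h1 := congrArg Subtype.val h0
    rw [hga, augmentation_single] at h1
    rcases mul_eq_zero.mp h1 with h2 | h2
    · rw [hga, h2, Finsupp.single_zero]
      exact Submodule.zero_mem _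
    · exact absurd (MvPolynomial.monomial_eq_zero.mp h2) one_ne_zero
  · obtain ⟨q, hq⟩ := X_dvd_of_sum_eq_zero (v := Q.var a) (a := a)
      (fun b hb hba => Q.exponent_lt a b (lt_of_le_of_ne (hg b hb) hba)) hsum
    set g' := g - q • Q.relation K a with hg'
    have hmem : q • Q.relation K a ∈ LinearMap.range (Q.relationMap K) :=
      Submodule.smul_mem _ _ ⟨Finsupp.single ⟨a, ha⟩ 1, by simp [relationMap]⟩
    suffices g' ∈ LinearMap.range (Q.relationMap K) by
      have h := Submodule.add_mem _ this hmem
      rwa [hg', sub_add_cancel] at h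
    have hlt : ∀ b ∈ g'.support, b < a := by
      intro b hb
      by_contra! hab
      apply Finsupp.mem_support_iff.mp hb
      rcases hab.eq_or_lt with rfl | hab
      · rw [hg', Finsupp.sub_apply, Finsupp.smul_apply, Q.relation_self ha, hq, smul_eq_mul,
          mul_comm, sub_self]
      · rw [hg', Finsupp.sub_apply, Finsupp.smul_apply, Q.relation_of_lt ha hab, smul_zero,
          sub_zero]
        by_contra h
        exact (hg b (Finsupp.mem_support_iff.mpr h)).not_gt hab
    by_cases hz : g' = 0
    · rw [hz]; exact Submodule.zero_mem _
    obtain ⟨b, hb, hmax⟩ := g'.support.exists_max_image id (Finsupp.support_nonempty_iff.mpr hz)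
    refine ih b (hlt b hb) g' hmax ?_
    rw [hg', map_sub, map_smul, h0, Q.augmentation_relation ha, smul_zero, sub_zero]

theorem exact_relationMap : Function.Exact (Q.relationMap K) (Q.augmentation K) := by
  intro g
  constructor
  · intro h
    have : Nonempty Q.index := ⟨Q.bot⟩
    obtain ⟨a, ha⟩ := Finite.exists_max (id : Q.index → Q.index)
    exact Q.mem_range_relationMap a g (fun b _ => ha b) h
  · rintro ⟨f, rfl⟩
    rw [relationMap, Finsupp.linearCombination_apply, map_finsuppSum]
    refine Finset.sum_eq_zero fun a _ => ?_
    dsimp only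
    rw [map_smul, Q.augmentation_relation a.2, smul_zero]

/-- The degree of a monomial. -/
noncomputable def degree (a : Q.index) : ℤ := (Q.exponent a).degree

/-- The index sets of the resolution. -/
def resolutionIndex : ℕ → Type
  | 0 => Q.index
  | 1 => {a // a ≠ Q.bot}
  | _ + 2 => Empty

/-- The degrees of the basis elements of the resolution. -/
noncomputable def resolutionDegree : (i : ℕ) → Q.resolutionIndex i → ℤ
  | 0 => Q.degree
  | 1 => fun a => Q.degree a.1 + 1
  | _ + 2 => Empty.elim

variable (K) in
/-- The differentials of the resolution. -/
noncomputable def resolutionMap : (i : ℕ) →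
    (Q.resolutionIndex (i + 1) →₀ MvPolynomial V K) →ₗ[MvPolynomial V K]
      (Q.resolutionIndex i →₀ MvPolynomial V K)
  | 0 => Q.relationMap K
  | _ + 1 => 0

theorem relation_mem {a : Q.index} (ha : a ≠ Q.bot) :
    Q.relation K a ∈ freeGrading K V Q.degree (Q.degree a + 1) := by
  refine Submodule.sub_mem _ (single_mem_freeGrading _ _ ?_) (single_mem_freeGrading _ _ ?_)
  · simpa using X_mem_polyGrading _
  · have h := congrArg Finsupp.degree (tsub_add_cancel_of_le (Q.exponent_parent_le a ha))
    have h' := monomial_mem_polyGrading (K := K)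
      (Q.exponent a + Finsupp.single (Q.var a) 1 - Q.exponent (Q.parent a)) 1
    rw [map_add, map_add, Finsupp.degree_single] at h
    convert h' using 2
    simp only [degree]
    omega

theorem relationMap_single_mem (a : {a // a ≠ Q.bot}) :
    Q.relationMap K (Finsupp.single a 1) ∈ freeGrading K V Q.degree (Q.degree a.1 + 1) := by
  simpa [relationMap] using Q.relation_mem a.2

theorem augmentation_mem (j : ℤ) (f : Q.index →₀ MvPolynomial V K)
    (hf : f ∈ freeGrading K V Q.degree j) :
    Q.augmentation K f ∈ idealGrading (Q.ideal K) j := by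
  change (Q.augmentation K f : MvPolynomial V K) ∈ polyGrading K V j
  rw [coe_augmentation]
  refine Submodule.sum_mem _ fun a _ => ?_
  have := mul_mem_polyGrading (hf a) (monomial_mem_polyGrading (K := K) (Q.exponent a) 1)
  change _ ∈ polyGrading K V (j - Q.degree a + Q.degree a) at this
  rwa [sub_add_cancel] at this

theorem exact_zero_relationMap {N : Type*} [AddCommGroup N] [Module (MvPolynomial V K) N] :
    Function.Exact (0 : N →ₗ[MvPolynomial V K] _) (Q.relationMap K) := by
  intro f
  rw [Q.relationMap_injective.eq_iff' (map_zero _)]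
  simp [eq_comm]

variable (K) in
/-- The length-one graded free resolution of the ideal generated by the monomials. -/
noncomputable def resolution : GradedFreeResolution (V := V) (idealGrading (Q.ideal K)) where
  ι := Q.resolutionIndex
  δ := Q.resolutionDegree
  d := Q.resolutionMap K
  ε := Q.augmentation K
  d_mem
    | 0 => mem_freeGrading_of_basis _ Q.relationMap_single_mem
    | _ + 1 => fun _ _ _ => Submodule.zero_mem _
  ε_mem := Q.augmentation_mem
  ε_surjective := Q.augmentation_surjective
  exact_zero := Q.exact_relationMap
  exact_succ
    | 0 => Q.exact_zero_relationMap
    | _ + 1 => fun f => by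
        have : Subsingleton (Empty →₀ MvPolynomial V K) := inferInstance
        exact ⟨fun _ => ⟨0, this.elim _ _⟩, fun _ => rfl⟩

/-- In the coordinate of the last generator, every relation is either zero or a variable. Boundaries
thus vanish there modulo the maximal ideal, whereas the basis vector gives `1`. -/
theorem torGrading_resolution_ne_bot {a : Q.index} (ha : ∀ b, b ≤ a) :
    (Q.resolution K).torGrading 0 (Q.degree a) ≠ ⊥ := by
  intro h
  have hmem : ((Submodule.Quotient.mk ⟨(Q.resolution K).toFiber 0 (Finsupp.single a 1),
      Submodule.mem_top⟩ : (Q.resolution K).Tor 0)) ∈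
      (Q.resolution K).torGrading 0 (Q.degree a) :=
    ⟨_, ⟨Finsupp.single a 1, single_one_mem_freeGrading (ι := Q.index) Q.degree a, rfl⟩, rfl⟩
  rw [h, Submodule.mem_bot, Submodule.Quotient.mk_eq_zero] at hmem
  obtain ⟨y, hy⟩ := hmem
  change (Q.relationMap K).rTensor (ResidueModule K V) y =
    (Finsupp.single a (1 : MvPolynomial V K)) ⊗ₜ[MvPolynomial V K] (1 : ResidueModule K V) at hy
  have hzero : (Finsupp.lapply a).rTensor (ResidueModule K V) ∘ₗ
      (Q.relationMap K).rTensor (ResidueModule K V) = 0 := by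
    rw [← LinearMap.rTensor_comp]
    refine TensorProduct.ext' fun f k => ?_
    rw [LinearMap.rTensor_tmul, LinearMap.zero_apply, LinearMap.comp_apply, relationMap,
      Finsupp.linearCombination_apply, map_finsuppSum, Finsupp.sum, TensorProduct.sum_tmul]
    refine Finset.sum_eq_zero fun b _ => ?_
    rw [map_smul, Finsupp.lapply_apply, smul_eq_mul, mul_comm]
    refine GradedFreeResolution.smul_tmul_residue ?_ _ _
    rcases (ha b.1).eq_or_lt with hb | hb
    · rw [← hb, Q.relation_self b.2]
      exact Ideal.subset_span ⟨_, rfl⟩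
    · rw [Q.relation_of_lt b.2 hb]
      exact Submodule.zero_mem _
  have h1 : (Finsupp.lapply a).rTensor (ResidueModule K V)
      ((Q.relationMap K).rTensor (ResidueModule K V) y) = 0 := LinearMap.congr_fun hzero y
  rw [hy, LinearMap.rTensor_tmul, Finsupp.lapply_apply,
    Finsupp.single_eq_same] at h1
  have h2 := congrArg (TensorProduct.lid (MvPolynomial V K) (ResidueModule K V)) h1
  rw [TensorProduct.lid_tmul, one_smul, map_zero] at h2
  have h3 := Ideal.Quotient.eq_zero_iff_mem.mp (show Ideal.Quotient.mk (Ideal.span (Set.range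
    (MvPolynomial.X : V → MvPolynomial V K))) 1 = 0 from h2)
  rw [← Set.image_univ, MvPolynomial.mem_ideal_span_X_image] at h3
  obtain ⟨v, -, hv⟩ := h3 0 (by simp)
  exact hv rfl

/-- The regularity of an ideal with linear quotients is the largest degree of a generator, here
attained at the last one. -/
theorem hasRegularity (a : Q.index) (ha : ∀ b, b ≤ a) (hdeg : ∀ b, Q.degree b ≤ Q.degree a) :
    HasRegularity (V := V) (idealGrading (Q.ideal K)) (Q.degree a) := by
  constructor
  · exact ⟨Q.resolution K, 0, Q.degree a, Q.torGrading_resolution_ne_bot ha, by simp⟩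
  -- Relations have degree one more than their generator, which the homological degree `1` offsets
  -- exactly.
  · rintro t ⟨F, i, j, h, rfl⟩
    obtain ⟨b, rfl⟩ := F.exists_degree_of_torGrading_ne_bot (Q.resolution K) h
    match i, b with
    | 0, b =>
      have : Q.degree b ≤ _ := hdeg b
      change Q.degree b - _ ≤ _
      simpa using this
    | 1, b =>
      have : Q.degree b.1 ≤ _ := hdeg b.1
      change Q.degree b.1 + 1 - _ ≤ _
      simpa using this
    | i + 2, b => exact b.elim

end MonomialLinearQuotients

end LinearQuotients

/-! ### Associated primes and symbolic powers of the cover ideal. -/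

section SymbolicPowers

variable {K V : Type*} [Field K]

variable (K) in
/-- The substitution `X v ↦ t ^ w v * X v`, which records the `w`-weights of monomials. -/
noncomputable def weightHom (w : V → ℕ) :
    MvPolynomial V K →+* Polynomial (MvPolynomial V K) :=
  MvPolynomial.eval₂Hom (Polynomial.C.comp MvPolynomial.C)
    fun v => Polynomial.X ^ w v * Polynomial.C (MvPolynomial.X v)

theorem weightHom_monomial (w : V → ℕ) (m : V →₀ ℕ) (c : K) :
    weightHom K w (MvPolynomial.monomial m c) =
      Polynomial.C (MvPolynomial.monomial m c) * Polynomial.X ^ Finsupp.weight w m := by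
  rw [weightHom, MvPolynomial.coe_eval₂Hom, MvPolynomial.eval₂_monomial, RingHom.comp_apply,
    MvPolynomial.monomial_eq, map_mul, mul_assoc]
  congr 1
  simp only [mul_pow, Finsupp.prod, Finset.prod_mul_distrib, map_prod, map_pow, ← pow_mul]
  rw [mul_comm]
  congr 1
  rw [Finset.prod_pow_eq_pow_sum, Finsupp.weight_apply, Finsupp.sum]
  simp only [smul_eq_mul, mul_comm]

theorem coeff_weightHom (w : V → ℕ) (f : MvPolynomial V K) (k : ℕ) (m : V →₀ ℕ) :
    ((weightHom K w f).coeff k).coeff m = if Finsupp.weight w m = k then f.coeff m else 0 := by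
  classical
  induction f using MvPolynomial.induction_on' with
  | monomial m' c =>
    rw [weightHom_monomial, Polynomial.coeff_C_mul, Polynomial.coeff_X_pow]
    by_cases h : m' = m
    · subst h
      by_cases h' : Finsupp.weight w m' = k
      · rw [if_pos h'.symm, if_pos h', mul_one]
      · rw [if_neg (Ne.symm h'), if_neg h', mul_zero, MvPolynomial.coeff_zero]
    · split_ifs <;> simp [MvPolynomial.coeff_monomial, h]
  | add p q hp hq =>
    rw [map_add, Polynomial.coeff_add, MvPolynomial.coeff_add, hp, hq, MvPolynomial.coeff_add]
    split_ifs <;> simp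

variable (K) in
/-- The ideal of polynomials all of whose monomials have `w`-weight at least `s`. -/
noncomputable def weightIdeal (w : V → ℕ) (s : ℕ) : Ideal (MvPolynomial V K) :=
  (Ideal.span {Polynomial.X ^ s}).comap (weightHom K w)

theorem mem_weightIdeal_iff_dvd {w : V → ℕ} {s : ℕ} {f : MvPolynomial V K} :
    f ∈ weightIdeal K w s ↔ Polynomial.X ^ s ∣ weightHom K w f := by
  rw [weightIdeal, Ideal.mem_comap, Ideal.mem_span_singleton]

theorem mem_weightIdeal {w : V → ℕ} {s : ℕ} {f : MvPolynomial V K} :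
    f ∈ weightIdeal K w s ↔ ∀ m ∈ f.support, s ≤ Finsupp.weight w m := by
  rw [mem_weightIdeal_iff_dvd, Polynomial.X_pow_dvd_iff]
  constructor
  · intro h m hm
    by_contra! hlt
    have := congrArg (MvPolynomial.coeff m) (h _ hlt)
    rw [coeff_weightHom, if_pos rfl] at this
    exact MvPolynomial.mem_support_iff.mp hm this
  · intro h d hd
    ext m
    rw [coeff_weightHom, MvPolynomial.coeff_zero]
    split_ifs with hw
    · by_contra hm
      have := h m (MvPolynomial.mem_support_iff.mpr hm)
      omega
    · rfl

theorem monomial_mem_weightIdeal {w : V → ℕ} {s : ℕ} {m : V →₀ ℕ} (c : K)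
    (hm : s ≤ Finsupp.weight w m) : MvPolynomial.monomial m c ∈ weightIdeal K w s := by
  classical
  rw [mem_weightIdeal]
  intro m' hm'
  rw [MvPolynomial.support_monomial] at hm'
  split_ifs at hm' with h
  · simp at hm'
  · rwa [Finset.mem_singleton.mp hm']

theorem monomial_one_mem_weightIdeal_iff {w : V → ℕ} {s : ℕ} {m : V →₀ ℕ} :
    MvPolynomial.monomial m (1 : K) ∈ weightIdeal K w s ↔ s ≤ Finsupp.weight w m := by
  refine ⟨fun h => mem_weightIdeal.mp h m ?_, monomial_mem_weightIdeal 1⟩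
  classical
  rw [MvPolynomial.mem_support_iff, MvPolynomial.coeff_monomial, if_pos rfl]
  exact one_ne_zero

/-- It is the pullback of the prime ideal `(t)`. For `pairWeight i j` with `i ≠ j` this is the prime
`(x_i, x_j)`. -/
instance weightIdeal_one_isPrime (w : V → ℕ) : (weightIdeal K w 1).IsPrime := by
  have : (Ideal.span {(Polynomial.X : Polynomial (MvPolynomial V K))}).IsPrime :=
    (Ideal.span_singleton_prime Polynomial.X_ne_zero).mpr Polynomial.prime_X
  rw [weightIdeal, pow_one]
  exact Ideal.comap_isPrime _ _

/-- The primary property of the weight ideals: `t` is prime in the polynomial ring, so a factor not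
divisible by it can be cancelled from divisibility by `t ^ s`. -/
theorem mem_weightIdeal_of_mul_mem {w : V → ℕ} {s : ℕ} {t f : MvPolynomial V K}
    (ht : t ∉ weightIdeal K w 1) (h : t * f ∈ weightIdeal K w s) : f ∈ weightIdeal K w s := by
  rw [mem_weightIdeal_iff_dvd] at *
  rw [pow_one] at ht
  rw [map_mul] at h
  exact Polynomial.prime_X.pow_dvd_of_dvd_mul_left s ht h

theorem pow_le_weightIdeal {w : V → ℕ} {I : Ideal (MvPolynomial V K)}
    (hI : I ≤ weightIdeal K w 1) (s : ℕ) : I ^ s ≤ weightIdeal K w s := by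
  refine (Ideal.pow_right_mono hI s).trans ((Ideal.le_comap_pow _ s).trans ?_)
  rw [pow_one, Ideal.span_singleton_pow]
  rfl

open Classical in
/-- The weight function giving the monomial with exponents `m` the weight `m i + m j`. -/
noncomputable def pairWeight (i j : V) (v : V) : ℕ :=
  (if v = i then 1 else 0) + (if v = j then 1 else 0)

theorem weight_pairWeight (i j : V) (m : V →₀ ℕ) :
    Finsupp.weight (pairWeight i j) m = m i + m j := by
  classical
  rw [Finsupp.weight_apply, Finsupp.sum]
  simp only [pairWeight, smul_eq_mul, mul_add, Finset.sum_add_distrib, mul_ite, mul_one, mul_zero,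
    Finset.sum_ite_eq', Finsupp.mem_support_iff]
  congr 1 <;> · split_ifs with h <;> simp_all

variable [Fintype V]

open Classical in
/-- The exponent vector with value `c` at `i` and `d` elsewhere. -/
noncomputable def starExponent (i : V) (c d : ℕ) : V →₀ ℕ :=
  Finsupp.equivFunOnFinite.symm fun v => if v = i then c else d

theorem starExponent_self (i : V) (c d : ℕ) : starExponent i c d i = c := by
  simp [starExponent]

theorem starExponent_of_ne {i v : V} (h : v ≠ i) (c d : ℕ) : starExponent i c d v = d := by
  simp [starExponent, h]

theorem degree_starExponent (i : V) (c d : ℕ) :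
    (starExponent i c d).degree = c + (Fintype.card V - 1) * d := by
  classical
  rw [Finsupp.degree_eq_sum, ← Finset.add_sum_erase _ _ (Finset.mem_univ i), starExponent_self,
    Finset.sum_congr rfl fun v hv => starExponent_of_ne (Finset.ne_of_mem_erase hv) c d]
  simp

theorem isMinimalVertexCover_top_iff [DecidableEq V] [Nonempty V] {C : Finset V} :
    IsMinimalVertexCover (⊤ : SimpleGraph V) C ↔ ∃ i, C = Finset.univ.erase i := by
  have hcov (i : V) : (⊤ : SimpleGraph V).IsVertexCover (Finset.univ.erase i : Finset V) := by
    intro v w hvw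
    by_contra! h
    simp at h
    exact hvw (h.1.trans h.2.symm)
  have hex (D : Finset V) (hD : (⊤ : SimpleGraph V).IsVertexCover (D : Set V)) :
      ∃ i, Finset.univ.erase i ⊆ D := by
    by_cases h : ∃ i, i ∉ D
    · obtain ⟨i, hi⟩ := h
      refine ⟨i, fun v hv => ?_⟩
      exact (hD (show (⊤ : SimpleGraph V).Adj i v from (Finset.ne_of_mem_erase hv).symm)).resolve_left
        (by simpa using hi)
    · push Not at h
      exact ⟨Classical.arbitrary V, fun v _ => h v⟩
  constructor
  · intro h
    have hmin : Minimal (fun C : Finset V => (⊤ : SimpleGraph V).IsVertexCover (C : Set V)) C := h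
    obtain ⟨i, hi⟩ := hex C hmin.prop
    exact ⟨i, (hmin.eq_of_le (hcov i) hi).symm⟩
  · rintro ⟨i, rfl⟩
    refine ⟨hcov i, fun D hD hle => ?_⟩
    obtain ⟨j, hj⟩ := hex D hD
    have hij : j = i := by
      by_contra hne
      have := hle (hj (Finset.mem_erase.mpr ⟨Ne.symm hne, Finset.mem_univ i⟩))
      simp at this
    exact hij ▸ hj

theorem coverIdealDeg_top [Nonempty V] :
    coverIdealDeg (⊤ : SimpleGraph V) = Fintype.card V - 1 := by
  classical
  apply le_antisymm
  · refine Finset.sup_le fun C hC => ?_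
    obtain ⟨i, rfl⟩ := isMinimalVertexCover_top_iff.mp (Finset.mem_filter.mp hC).2
    simp
  · have h := Finset.le_sup (f := Finset.card) (Finset.mem_filter.mpr
      ⟨Finset.mem_univ _, isMinimalVertexCover_top_iff.mpr ⟨Classical.arbitrary V, rfl⟩⟩)
    rw [Finset.card_erase_of_mem (Finset.mem_univ _), Finset.card_univ] at h
    exact h

theorem monomial_starExponent [DecidableEq V] (i : V) :
    MvPolynomial.monomial (starExponent i 0 1) (1 : K) =
      ∏ v ∈ Finset.univ.erase i, MvPolynomial.X v := by
  rw [MvPolynomial.monomial_eq, map_one, one_mul,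
    Finsupp.prod_fintype _ _ (fun _ => pow_zero _),
    ← Finset.mul_prod_erase _ _ (Finset.mem_univ i), starExponent_self, pow_zero, one_mul]
  exact Finset.prod_congr rfl fun v hv => by
    rw [starExponent_of_ne (Finset.ne_of_mem_erase hv), pow_one]

theorem coverIdeal_top [Nonempty V] :
    coverIdeal K (⊤ : SimpleGraph V) = Ideal.span
      ((fun m => MvPolynomial.monomial m (1 : K)) '' Set.range fun i : V => starExponent i 0 1) := by
  classical
  rw [coverIdeal]
  congr 1
  ext f
  simp only [isMinimalVertexCover_top_iff, Set.mem_image, Set.mem_range, Set.mem_ofPred_eq]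
  constructor
  · rintro ⟨_, ⟨i, rfl⟩, rfl⟩
    exact ⟨_, ⟨i, rfl⟩, monomial_starExponent i⟩
  · rintro ⟨_, ⟨i, rfl⟩, rfl⟩
    exact ⟨_, ⟨i, rfl⟩, monomial_starExponent i⟩

/-- A monomial is divisible by some `∏_{v ≠ k} x_v` exactly when no two of its exponents vanish
together. -/
theorem mem_coverIdeal_top [Nonempty V] {f : MvPolynomial V K} :
    f ∈ coverIdeal K (⊤ : SimpleGraph V) ↔
      ∀ i j, i ≠ j → f ∈ weightIdeal K (pairWeight i j) 1 := by
  rw [coverIdeal_top, MvPolynomial.mem_ideal_span_monomial_image]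
  simp only [mem_weightIdeal, weight_pairWeight]
  constructor
  · intro h i j hij m hm
    obtain ⟨_, ⟨k, rfl⟩, hk⟩ := h m hm
    by_cases hik : i = k
    · have := hk j
      simp only [starExponent_of_ne (hik ▸ hij.symm)] at this
      omega
    · have := hk i
      simp only [starExponent_of_ne hik] at this
      omega
  · intro h m hm
    obtain ⟨k, hk⟩ : ∃ k, ∀ v, v ≠ k → 1 ≤ m v := by
      by_cases hz : ∃ k, m k = 0
      · obtain ⟨k, hk⟩ := hz
        refine ⟨k, fun v hv => ?_⟩
        have := h v k hv m hm
        omega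
      · push Not at hz
        exact ⟨Classical.arbitrary V, fun v _ => Nat.one_le_iff_ne_zero.mpr (hz v)⟩
    refine ⟨_, ⟨k, rfl⟩, fun v => ?_⟩
    by_cases hv : v = k
    · simp [hv, starExponent_self]
    · simpa only [starExponent_of_ne hv] using hk v hv

open Classical in
/-- The exponent vector of the product of all variables except `i` and `j`. -/
noncomputable def pairComplement (i j : V) : V →₀ ℕ :=
  Finsupp.equivFunOnFinite.symm fun v => if v = i ∨ v = j then 0 else 1

theorem pairComplement_apply [DecidableEq V] (i j v : V) :
    pairComplement i j v = if v = i ∨ v = j then 0 else 1 := by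
  simp [pairComplement]

theorem monomial_pairComplement_notMem (i j : V) :
    MvPolynomial.monomial (pairComplement i j) (1 : K) ∉ weightIdeal K (pairWeight i j) 1 := by
  classical
  rw [monomial_one_mem_weightIdeal_iff, weight_pairWeight, pairComplement_apply,
    pairComplement_apply]
  simp

/-- The product of all other variables lies in every prime belonging to another pair, so it
multiplies `(x_i, x_j)` into the cover ideal. -/
theorem mul_monomial_pairComplement_mem [Nonempty V] {i j : V}
    {f : MvPolynomial V K} (hf : f ∈ weightIdeal K (pairWeight i j) 1) :
    f * MvPolynomial.monomial (pairComplement i j) 1 ∈ coverIdeal K (⊤ : SimpleGraph V) := by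
  classical
  rw [mem_coverIdeal_top]
  intro k l hkl
  by_cases h : (k = i ∨ k = j) ∧ (l = i ∨ l = j)
  · have : pairWeight k l = pairWeight i j := by
      funext v
      unfold pairWeight
      rcases h with ⟨rfl | rfl, rfl | rfl⟩
      · exact absurd rfl hkl
      · rfl
      · exact add_comm _ _
      · exact absurd rfl hkl
    rw [this]
    exact Ideal.mul_mem_right _ _ hf
  · refine Ideal.mul_mem_left _ _ (monomial_mem_weightIdeal 1 ?_)
    rw [weight_pairWeight, pairComplement_apply, pairComplement_apply]
    split_ifs <;> first | omega | tauto

theorem mem_associatedPrimes_coverIdeal_top [Nonempty V] {P : Ideal (MvPolynomial V K)} :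
    P ∈ associatedPrimes (MvPolynomial V K)
        (MvPolynomial V K ⧸ coverIdeal K (⊤ : SimpleGraph V)) ↔
      ∃ i j, i ≠ j ∧ P = weightIdeal K (pairWeight i j) 1 := by
  classical
  have hcolon (a f : MvPolynomial V K) :
      a ∈ Submodule.colon (⊥ : Submodule (MvPolynomial V K)
        (MvPolynomial V K ⧸ coverIdeal K (⊤ : SimpleGraph V))) {Ideal.Quotient.mk _ f} ↔
      a * f ∈ coverIdeal K (⊤ : SimpleGraph V) := by
    rw [Submodule.mem_colon_singleton, Submodule.mem_bot, ← Ideal.Quotient.eq_zero_iff_mem]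
    rfl
  rw [AssociatedPrimes.mem_iff, isAssociatedPrime_iff]
  constructor
  · rintro ⟨hP, x, hx⟩
    obtain ⟨f, rfl⟩ := Ideal.Quotient.mk_surjective x
    -- The annihilator of `f` modulo the cover ideal contains the finite intersection of those pair
    -- primes that miss `f`. Being prime, it contains one of them, and the reverse inclusion follows
    -- from primality of that one.
    have hle : ((Finset.univ.filter fun q : V × V => q.1 ≠ q.2 ∧
        f ∉ weightIdeal K (pairWeight q.1 q.2) 1).inf
          fun q => weightIdeal K (pairWeight q.1 q.2) 1) ≤ P := by
      intro a ha
      rw [Submodule.mem_finsetInf] at ha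
      rw [hx, hcolon, mem_coverIdeal_top]
      intro i j hij
      by_cases hf : f ∈ weightIdeal K (pairWeight i j) 1
      · exact Ideal.mul_mem_left _ _ hf
      · exact Ideal.mul_mem_right _ _ (ha (i, j) (by simp [hij, hf]))
    obtain ⟨⟨i, j⟩, hq, hPq⟩ := hP.inf_le'.mp hle
    obtain ⟨-, hij, hf⟩ := Finset.mem_filter.mp hq
    refine ⟨i, j, hij, le_antisymm (fun a ha => ?_) hPq⟩
    rw [hx, hcolon, mem_coverIdeal_top] at ha
    exact ((weightIdeal_one_isPrime _).mem_or_mem (ha i j hij)).resolve_right hf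
  · rintro ⟨i, j, hij, rfl⟩
    refine ⟨inferInstance, Ideal.Quotient.mk _
      (MvPolynomial.monomial (pairComplement i j) 1), Ideal.ext fun a => ?_⟩
    rw [hcolon]
    refine ⟨mul_monomial_pairComplement_mem, fun h => ?_⟩
    exact ((weightIdeal_one_isPrime _).mem_or_mem (mem_coverIdeal_top.mp h i j hij)).resolve_right
      (monomial_pairComplement_notMem i j)

/-- With `r` the product of the other variables, `r x_i` and `r x_j` lie in the cover ideal.
Spending one factor `r` on each of `s` factors `x_i` or `x_j` lands in its `s`-th power. -/
theorem mul_pow_pairComplement_mem [Nonempty V] {i j : V} (hij : i ≠ j) {s : ℕ}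
    {f : MvPolynomial V K} (hf : f ∈ weightIdeal K (pairWeight i j) s) :
    (MvPolynomial.monomial (pairComplement i j) 1) ^ s * f ∈
      coverIdeal K (⊤ : SimpleGraph V) ^ s := by
  classical
  have hX (k : V) (hk : k = i ∨ k = j) :
      MvPolynomial.X k ∈ weightIdeal K (pairWeight i j) 1 := by
    refine monomial_mem_weightIdeal 1 ?_
    rw [weight_pairWeight]
    rcases hk with rfl | rfl <;> simp
  rw [f.as_sum, Finset.mul_sum]
  refine Submodule.sum_mem _ fun m hm => ?_
  have hw := mem_weightIdeal.mp hf m hm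
  rw [weight_pairWeight] at hw
  obtain ⟨a, b, ha, hb, rfl⟩ : ∃ a b, a ≤ m i ∧ b ≤ m j ∧ s = a + b :=
    ⟨min s (m i), s - min s (m i), by omega, by omega, by omega⟩
  have hle : Finsupp.single i a + Finsupp.single j b ≤ m := by
    intro v
    rw [Finsupp.add_apply, Finsupp.single_apply, Finsupp.single_apply]
    split_ifs with h1 h2 h2
    · exact absurd (h1.trans h2.symm) hij
    · simpa [← h1] using ha
    · simpa [← h2] using hb
    · simp
  have hm' : MvPolynomial.monomial m (f.coeff m) =
      MvPolynomial.monomial (m - (Finsupp.single i a + Finsupp.single j b)) (f.coeff m) *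
        (MvPolynomial.X i ^ a * MvPolynomial.X j ^ b) := by
    rw [MvPolynomial.X_pow_eq_monomial, MvPolynomial.X_pow_eq_monomial, MvPolynomial.monomial_mul,
      MvPolynomial.monomial_mul, tsub_add_cancel_of_le hle]
    simp
  set r : MvPolynomial V K := MvPolynomial.monomial (pairComplement i j) 1 with hr
  have hprod : r ^ (a + b) * MvPolynomial.monomial m (f.coeff m) =
      MvPolynomial.monomial (m - (Finsupp.single i a + Finsupp.single j b)) (f.coeff m) *
        ((MvPolynomial.X i * r) ^ a * (MvPolynomial.X j * r) ^ b) := by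
    rw [hm']
    ring
  rw [hprod, pow_add]
  exact Ideal.mul_mem_left _ _ (Ideal.mul_mem_mul
    (Ideal.pow_mem_pow (mul_monomial_pairComplement_mem (hX i (Or.inl rfl))) a)
    (Ideal.pow_mem_pow (mul_monomial_pairComplement_mem (hX j (Or.inr rfl))) b))

/-- The symbolic powers of the cover ideal of a complete graph. -/
theorem mem_symbolicPower_coverIdeal_top [Nonempty V] {s : ℕ} {f : MvPolynomial V K} :
    f ∈ symbolicPower (coverIdeal K (⊤ : SimpleGraph V)) s ↔
      ∀ m ∈ f.support, ∀ i j, i ≠ j → s ≤ m i + m j := by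
  have hiff : f ∈ symbolicPower (coverIdeal K (⊤ : SimpleGraph V)) s ↔
      ∀ i j, i ≠ j → f ∈ weightIdeal K (pairWeight i j) s := by
    simp only [symbolicPower, Submodule.mem_iInf, Ideal.mem_comap]
    constructor
    · intro h i j hij
      have h1 := h ⟨weightIdeal K (pairWeight i j) 1, inferInstance⟩
        (mem_associatedPrimes_coverIdeal_top.mpr ⟨i, j, hij, rfl⟩)
      rw [IsLocalization.algebraMap_mem_map_algebraMap_iff
        (weightIdeal K (pairWeight i j) 1).primeCompl] at h1
      obtain ⟨t, ht, htf⟩ := h1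
      exact mem_weightIdeal_of_mul_mem ht (pow_le_weightIdeal
        (fun g hg => mem_coverIdeal_top.mp hg i j hij) s htf)
    · rintro h ⟨P, hP⟩ hass
      obtain ⟨i, j, hij, hPij⟩ := mem_associatedPrimes_coverIdeal_top.mp hass
      dsimp only at hPij
      subst hPij
      rw [IsLocalization.algebraMap_mem_map_algebraMap_iff
        (weightIdeal K (pairWeight i j) 1).primeCompl]
      -- The denominator is a power of the complementary monomial, which lies outside the prime.
      refine ⟨(MvPolynomial.monomial (pairComplement i j) 1) ^ s, ?_,
        mul_pow_pairComplement_mem hij (h i j hij)⟩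
      exact Submonoid.pow_mem _ (monomial_pairComplement_notMem i j) s
  rw [hiff]
  simp only [mem_weightIdeal, weight_pairWeight]
  exact ⟨fun h m hm i j hij => h i j hij m hm, fun h i j hij m hm => h m hm i j hij⟩

end SymbolicPowers

/-! ### Enumeration of the generators and the regularity of the symbolic powers. -/

section CompleteGraph

variable {K V : Type*} [Field K]

/-- The first index in the enumeration of the generators of a symbolic power: for even `s` the
generators number `0` to `n - 1` would coincide. -/
def firstIndex (n s : ℕ) : ℕ := if s % 2 = 0 then n - 1 else 0

theorem firstIndex_le (n s : ℕ) : firstIndex n s ≤ n * (s / 2) + (n - 1) := by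
  unfold firstIndex
  split_ifs <;> omega

/-- The variable belonging to an index in the enumeration of the generators. -/
noncomputable def indexVar {n : ℕ} [NeZero n] (e : Fin n ≃ V) (k : ℕ) : V := e (Fin.ofNat n k)

theorem indexVar_eq_iff {n : ℕ} [NeZero n] (e : Fin n ≃ V) (k l : ℕ) :
    indexVar e k = indexVar e l ↔ k % n = l % n := by
  rw [indexVar, indexVar, e.apply_eq_iff_eq, Fin.ext_iff]
  rfl

variable [Fintype V]

/-- The exponent vectors of the generators of a symbolic power. -/
noncomputable def generatorExponent {n : ℕ} [NeZero n] (e : Fin n ≃ V) (s k : ℕ) : V →₀ ℕ :=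
  starExponent (indexVar e k) (s / 2 - k / n) (s - (s / 2 - k / n))

theorem generatorExponent_apply [DecidableEq V] {n : ℕ} [NeZero n] (e : Fin n ≃ V) (s k : ℕ)
    (v : V) : generatorExponent e s k v =
      if v = indexVar e k then s / 2 - k / n else s - (s / 2 - k / n) := by
  rw [generatorExponent]
  split_ifs with h
  · rw [h, starExponent_self]
  · rw [starExponent_of_ne h]

/-- Index `k` stands for the vertex numbered `k % n` and `c = s / 2 - k / n`. Going back by `n`
keeps the vertex and raises `c` by one. When that falls before the first index, the first generator
serves: its exponents are at most `s - s / 2`. -/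
theorem generatorExponent_parent_le {n : ℕ} [NeZero n] (e : Fin n ≃ V) {s k : ℕ}
    (hkN : k ≤ n * (s / 2) + (n - 1)) :
    generatorExponent e s (max (k - n) (firstIndex n s)) ≤
      generatorExponent e s k + Finsupp.single (indexVar e k) 1 := by
  classical
  have hn : 0 < n := Nat.pos_of_neZero n
  intro v
  rw [Finsupp.add_apply, generatorExponent_apply, generatorExponent_apply, Finsupp.single_apply]
  have hq : k / n ≤ s / 2 := by
    rw [← Nat.lt_succ_iff, Nat.div_lt_iff_lt_mul hn, Nat.succ_mul, mul_comm]
    omega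
  by_cases hp : n ≤ k ∧ firstIndex n s ≤ k - n
  · rw [max_eq_left hp.2]
    have hvar : indexVar e (k - n) = indexVar e k := by
      rw [indexVar_eq_iff, ← Nat.mod_eq_sub_mod hp.1]
    have hdiv : (k - n) / n = k / n - 1 := by
      simpa using Nat.sub_mul_div k n 1
    have hpos : 1 ≤ k / n := (Nat.one_le_div_iff hn).mpr hp.1
    rw [hvar, hdiv]
    simp only [eq_comm (a := indexVar e k)]
    generalize k / n = q at hq hpos
    split_ifs <;> omega
  · have hmax : max (k - n) (firstIndex n s) = firstIndex n s := by
      apply max_eq_right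
      omega
    have hfirst : firstIndex n s / n = 0 := by
      rw [Nat.div_eq_zero_iff, firstIndex]
      split_ifs <;> omega
    rw [hmax, hfirst]
    simp only [eq_comm (a := indexVar e k)]
    unfold firstIndex at hp
    by_cases hs : s % 2 = 0
    · rw [if_pos hs] at hp
      have hpos : k / n ≤ 1 := by
        rw [← Nat.lt_succ_iff, Nat.div_lt_iff_lt_mul hn]
        omega
      generalize k / n = q at hq hpos
      split_ifs <;> omega
    · rw [if_neg hs] at hp
      have hzero : k / n = 0 := Nat.div_eq_of_lt (by omega)
      rw [hzero]
      split_ifs <;> omega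

/-- An earlier generator at the same vertex has larger `c`. At another vertex its exponent is `s -
c'` with `c' ≤ s / 2`, which exceeds `c` unless `s` is even and `c = c' = s / 2`; `firstIndex`
removes that tie. -/
theorem generatorExponent_lt {n : ℕ} [NeZero n] (e : Fin n ≃ V) {s k l : ℕ}
    (hl : firstIndex n s ≤ l) (hlk : l < k) (hkN : k ≤ n * (s / 2) + (n - 1)) :
    generatorExponent e s k (indexVar e k) < generatorExponent e s l (indexVar e k) := by
  classical
  have hn : 0 < n := Nat.pos_of_neZero n
  rw [generatorExponent_apply, generatorExponent_apply, if_pos rfl]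
  have hq : k / n ≤ s / 2 := by
    rw [← Nat.lt_succ_iff, Nat.div_lt_iff_lt_mul hn, Nat.succ_mul, mul_comm]
    omega
  have hle : l / n ≤ k / n := Nat.div_le_div_right hlk.le
  split_ifs with h
  · rw [indexVar_eq_iff] at h
    have hne : l / n ≠ k / n := by
      intro hd
      have h1 := Nat.div_add_mod l n
      have h2 := Nat.div_add_mod k n
      rw [hd] at h1
      omega
    generalize k / n = q at hq hle hne
    generalize l / n = q' at hle hne
    omega
  · by_cases hs : s % 2 = 0
    · rw [firstIndex, if_pos hs] at hl
      have : 1 ≤ k / n := (Nat.one_le_div_iff hn).mpr (by omega)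
      generalize k / n = q at hq hle this
      generalize l / n = q' at hle
      omega
    · generalize k / n = q at hq hle
      generalize l / n = q' at hle
      omega

/-- The generators of the `s`-th symbolic power of the cover ideal of a complete graph form a
family with linear quotients. -/
noncomputable def symbolicPowerQuotients {n : ℕ} [NeZero n] (e : Fin n ≃ V) (s : ℕ) :
    MonomialLinearQuotients V where
  -- The upper end is the last vertex in the layer `c = 0`.
  index := {k : ℕ // firstIndex n s ≤ k ∧ k ≤ n * (s / 2) + (n - 1)}
  finite := (Set.finite_Icc _ _).to_subtype
  bot := ⟨firstIndex n s, le_rfl, firstIndex_le n s⟩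
  exponent k := generatorExponent e s k
  var k := indexVar e k
  parent k := ⟨max (k - n) (firstIndex n s), le_max_right _ _,
    max_le ((Nat.sub_le _ _).trans k.2.2) (k.2.1.trans k.2.2)⟩
  bot_le k := k.2.1
  parent_lt k hk := by
    have hlt : firstIndex n s < k := lt_of_le_of_ne k.2.1 fun h => hk (Subtype.ext h.symm)
    have hn : 0 < n := Nat.pos_of_neZero n
    exact max_lt (Nat.sub_lt (by omega) hn) hlt
  exponent_parent_le k _ := generatorExponent_parent_le e k.2.2
  exponent_lt k l hlk := generatorExponent_lt e l.2.1 hlk k.2.2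

/-- For the converse take a vertex `i` of minimal exponent and `c = min (m i) (s / 2)`. The other
exponents are then at least `s - c`, by the pair condition or by minimality. -/
theorem exists_generatorExponent_le_iff {n : ℕ} [NeZero n] [Nonempty V] (e : Fin n ≃ V) {s : ℕ}
    (m : V →₀ ℕ) :
    (∃ k, (firstIndex n s ≤ k ∧ k ≤ n * (s / 2) + (n - 1)) ∧ generatorExponent e s k ≤ m) ↔
      ∀ i j, i ≠ j → s ≤ m i + m j := by
  classical
  have hn : 0 < n := Nat.pos_of_neZero n
  constructor
  · rintro ⟨k, -, hk⟩ i j hij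
    have hi := hk i
    have hj := hk j
    rw [generatorExponent_apply] at hi hj
    have hc : s / 2 - k / n ≤ s / 2 := Nat.sub_le _ _
    generalize s / 2 - k / n = c at hi hj hc
    split_ifs at hi hj with h1 h2
    · exact absurd (h1.trans h2.symm) hij
    all_goals omega
  · intro h
    obtain ⟨i, hi⟩ := Finite.exists_min m
    -- Here the top layer collapses to the single monomial with all exponents `s / 2`, which is kept
    -- only under index `n - 1`.
    by_cases hs : s % 2 = 0 ∧ s / 2 ≤ m i
    · refine ⟨n - 1, ⟨by rw [firstIndex, if_pos hs.1], by omega⟩, fun v => ?_⟩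
      have hv := hi v
      rw [generatorExponent_apply, Nat.div_eq_of_lt (Nat.sub_lt hn one_pos)]
      split_ifs <;> omega
    · set c := min (m i) (s / 2) with hc
      set r : Fin n := e.symm i with hr
      have hdiv : (n * (s / 2 - c) + r) / n = s / 2 - c := by
        rw [Nat.mul_add_div hn, Nat.div_eq_of_lt r.2, add_zero]
      have hvar : indexVar e (n * (s / 2 - c) + r) = i := by
        rw [indexVar, ← e.apply_symm_apply i, ← hr]
        congr 1
        apply Fin.ext
        simp [Fin.ofNat, Nat.mod_eq_of_lt r.2]
      refine ⟨n * (s / 2 - c) + r, ⟨?_, ?_⟩, fun v => ?_⟩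
      · unfold firstIndex
        split_ifs with h2
        -- For even `s` the remaining case has `c < s / 2`, so the index is at least `n` and hence
        -- past the omitted ones.
        · have : n * 1 ≤ n * (s / 2 - c) := Nat.mul_le_mul_left n (by omega)
          omega
        · omega
      · have : n * (s / 2 - c) ≤ n * (s / 2) := Nat.mul_le_mul_left n (by omega)
        have := r.2
        omega
      · rw [generatorExponent_apply, hdiv, hvar]
        split_ifs with hv
        · rw [hv]
          omega
        · have h1 := h v i hv
          have h2 := hi v
          omega

theorem ideal_symbolicPowerQuotients {n : ℕ} [NeZero n] [Nonempty V] (e : Fin n ≃ V) (s : ℕ) :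
    (symbolicPowerQuotients e s).ideal K =
      symbolicPower (coverIdeal K (⊤ : SimpleGraph V)) s := by
  ext f
  rw [mem_symbolicPower_coverIdeal_top, MonomialLinearQuotients.ideal,
    Set.range_comp' (fun m => MvPolynomial.monomial m (1 : K)),
    MvPolynomial.mem_ideal_span_monomial_image]
  refine forall₂_congr fun m _ => ?_
  rw [← exists_generatorExponent_le_iff e m, Set.exists_range_iff]
  exact ⟨fun ⟨k, hk⟩ => ⟨k.1, k.2, hk⟩, fun ⟨k, hk, hle⟩ => ⟨⟨k, hk⟩, hle⟩⟩

theorem degree_generatorExponent {n : ℕ} [NeZero n] (e : Fin n ≃ V) (s k : ℕ) :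
    (generatorExponent e s k).degree =
      (s / 2 - k / n) + (n - 1) * (s - (s / 2 - k / n)) := by
  rw [generatorExponent, degree_starExponent, Fintype.card_congr e.symm, Fintype.card_fin]

theorem hasRegularity_symbolicPower {n : ℕ} (hn : 2 ≤ n) (hV : Fintype.card V = n) (s : ℕ) :
    HasRegularity (V := V)
      (idealGrading (symbolicPower (coverIdeal K (⊤ : SimpleGraph V)) s))
      ((s * (n - 1) : ℕ) : ℤ) := by
  have : NeZero n := ⟨by omega⟩
  have : Nonempty V := Fintype.card_pos_iff.mp (by omega)
  let e := (Fintype.equivFinOfCardEq hV).symm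
  let Q := symbolicPowerQuotients e s
  let last : Q.index := ⟨n * (s / 2) + (n - 1), firstIndex_le n s, le_rfl⟩
  have hlast : Q.degree last = ((s * (n - 1) : ℕ) : ℤ) := by
    change (((generatorExponent e s (n * (s / 2) + (n - 1))).degree : ℕ) : ℤ) = _
    rw [degree_generatorExponent, Nat.mul_add_div (by omega),
      Nat.div_eq_of_lt (show n - 1 < n by omega)]
    simp [mul_comm]
  rw [← ideal_symbolicPowerQuotients e s, ← hlast]
  refine Q.hasRegularity last (fun k => k.2.2) fun k => ?_
  rw [hlast]
  change (((generatorExponent e s k.1).degree : ℕ) : ℤ) ≤ _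
  rw [degree_generatorExponent, Nat.cast_le]
  have hc : s / 2 - k.1 / n ≤ s := (Nat.sub_le _ _).trans (Nat.div_le_self _ _)
  generalize s / 2 - k.1 / n = c at hc
  obtain ⟨d, rfl⟩ := Nat.exists_eq_add_of_le hc
  obtain ⟨l, rfl⟩ := Nat.exists_eq_add_of_le hn
  rw [Nat.add_sub_cancel_left, show 2 + l - 1 = l + 1 by omega]
  -- With `s = c + d` and `n = l + 2`, the gap between the two degrees is exactly `c * l`.
  nlinarith [Nat.zero_le (c * l)]

/-- The unit ideal as an ideal with linear quotients. -/
noncomputable def unitQuotients (v : V) : MonomialLinearQuotients V where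
  index := Unit
  bot := ()
  exponent _ := 0
  var _ := v
  parent a := a
  bot_le _ := le_rfl
  parent_lt _ h := absurd rfl h
  exponent_parent_le _ h := absurd rfl h
  exponent_lt _ _ h := absurd h (lt_irrefl _)

/-- With one vertex there are no pairs to constrain exponents, so every symbolic power is the unit
ideal. -/
theorem hasRegularity_symbolicPower_of_card_eq_one (hV : Fintype.card V = 1) (s : ℕ) :
    HasRegularity (V := V)
      (idealGrading (symbolicPower (coverIdeal K (⊤ : SimpleGraph V)) s)) 0 := by
  obtain ⟨v, hv⟩ := Fintype.card_eq_one_iff.mp hV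
  have : Nonempty V := ⟨v⟩
  have hI : (unitQuotients v).ideal K = symbolicPower (coverIdeal K (⊤ : SimpleGraph V)) s := by
    trans ⊤
    · exact (Ideal.eq_top_iff_one _).mpr (Ideal.subset_span ⟨(), rfl⟩)
    · refine ((Ideal.eq_top_iff_one _).mpr (mem_symbolicPower_coverIdeal_top.mpr ?_)).symm
      exact fun _ _ i j hij => absurd ((hv i).trans (hv j).symm) hij
  have hdeg : (unitQuotients v).degree () = 0 := by
    change (((0 : V →₀ ℕ).degree : ℕ) : ℤ) = 0
    simp
  rw [← hI, ← hdeg]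
  exact (unitQuotients v).hasRegularity () (fun _ => le_rfl) fun _ => le_rfl

end CompleteGraph

theorem corollary4p7 {K V : Type*} [Field K] [Fintype V] (n : ℕ) (hn : 1 ≤ n)
    (hV : Fintype.card V = n) (G : SimpleGraph V) (hG : G = ⊤) (s : ℕ) (hs : 1 ≤ s) :
    HasRegularity (V := V) (idealGrading (symbolicPower (coverIdeal K G) s))
        ((s : ℤ) * (coverIdealDeg G : ℤ)) ∧
      (s : ℤ) * (coverIdealDeg G : ℤ) = (s : ℤ) * ((n : ℤ) - 1) := by
  subst hG
  have : Nonempty V := Fintype.card_pos_iff.mp (by omega)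
  rw [coverIdealDeg_top, hV]
  refine ⟨?_, by rw [Nat.cast_sub hn, Nat.cast_one]⟩
  -- For `n = 1` the degree `c + (n - 1)(s - c)` is just `c`, no longer maximal at `c = 0`, so this
  -- case is treated separately.
  rcases hn.eq_or_lt with rfl | hn
  · simpa using hasRegularity_symbolicPower_of_card_eq_one (K := K) hV s
  · rw [← Nat.cast_mul]
    exact hasRegularity_symbolicPower hn hV s
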